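/- **Setting.** Let $\mathcal X$ be a sample space with a $\sigma$-finite reference measure $\mathrm dz$, let $f_\theta$ ($\theta\in\mathbb R^d$) be probability densities with respect to $\mathrm dz$, fix $\theta_\star\in\mathbb R^d$, and let $Z\sim\mathbb P(\mathrm dz)=f_{\theta_\star}(z)\,\mathrm dz$, with expectation $\mathbb E$. Write $\|\cdot\|$ for the Euclidean norm, $\|\theta\|_0$ for the number of nonzero coordinates of $\theta$, $\|\theta\|_1=\sum_j|\theta_j|$, and $\|\theta\|_\infty=\max_j|\theta_j|$. *Prior.* For $\rho>0$ let $\Pi=\sum_{\delta\in\{0,1\}^d}\pi_\delta\,\Pi(\cdot\mid\delta)$ where, under $\Pi(\cdot\mid\delta)$, the coordinates are independent, $\theta_j=0$ if $\delta_j=0$, and $\theta_j$ has the Laplace density $\frac{\rho}{2}e^{-\rho|x|}$ if $\delta_j=1$. Assume (H2): $\pi_\delta=g_{\|\delta\|_0}\binom{d}{\|\delta\|_0}^{-1}$ for a probability distribution $(g_s)_{0\le s\le d}$ and constants $c_1,c_2>0$, $c_3\ge c_4>0$ with $$\frac{c_1}{d^{c_3}}g_{s-1}\le g_s\le\frac{c_2}{d^{c_4}}g_{s-1},\qquad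 s=1,\dots,d.$$ *Quasi-posterior.* Let $(\theta,z)\mapsto q_\theta(z)>0$ be jointly measurable with $0<\int q_\theta(z)\,\Pi(\mathrm d\theta)<\infty$ for $\mathrm dz$-almost every $z$, and such that $\theta\mapsto\log q_\theta(z)$ is concave and differentiable on $\mathbb R^d$ for every $z$. Put $\check\Pi(A\mid z)=\int_Aq_\theta(z)\,\Pi(\mathrm d\theta)\big/\int_{\mathbb R^d}q_\theta(z)\,\Pi(\mathrm d\theta)$ and $$\mathcal L_\theta(z)=\log q_\theta(z)-\log q_{\theta_\star}(z)-\langle\nabla\log q_{\theta_\star}(z),\theta-\theta_\star\rangle .$$ *Rate functions and cones.* A rate function is a continuous, strictly increasing $r:[0,\infty)\to[0,\infty)$ with $r(0)=0$ and $\lim_{x\downarrow0}r(x)/x=0$; $\phi_r(a)=\inf\{x>0: r(z)\ge az\text{ for all }z\ge x\}$ with $\inf\emptyset=+\infty$. A split cone is a nonempty (measurable) set $\Theta\subseteq\mathbb R^d$ closed under multiplication by scalars $t\ge0$ and under all sign changes of coordinates. Let $\Theta_\star=\{\theta:\theta_j=0\text{ whenever }\theta_{\star j}=0\}$ and $$\mathcal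 N=\Big\{\theta\ne0:\ \sum_{j:\theta_{\star j}=0}|\theta_j|\le7\sum_{j:\theta_{\star j}\ne0}|\theta_j|\Big\}.$$ *Events.* For $\Theta\subseteq\mathbb R^d$, $\lambda,L\ge0$ and a rate function $r$, let $$\mathcal E_0(\Theta,\lambda)=\{z:|\langle\nabla\log q_{\theta_\star}(z),u\rangle|\le\lambda/2\ \ \forall u\in\Theta,\ \|u\|=1\},$$ $$\hat{\mathcal E}_1(\Theta,L)=\{z:\mathcal L_\theta(z)\ge-\tfrac L2\|\theta-\theta_\star\|^2\ \ \forall\theta\in\theta_\star+\Theta\},\qquad \check{\mathcal E}_1(\Theta,r)=\{z:\mathcal L_\theta(z)\le-\tfrac12r(\|\theta-\theta_\star\|)\ \ \forall\theta\in\theta_\star+\Theta\}.$$ **Theorem.** In this setting let $s_\star=\|\theta_\star\|_0$ and suppose $d^{c_4}\ge8c_2$. Let $\bar\Theta\supseteq\Theta_\star$ be a split cone, $\bar L\ge0$, $\bar\lambda\ge0$, and $r$ a rate function such that $\bar\epsilon=\phi_r(2\bar\lambda)$ is finite. (1) Let $\mathcal E=\mathcal E_0(\mathbb R^d,\rho)\cap\hat{\mathcal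 E}_1(\Theta_\star,\bar L)\cap\check{\mathcal E}_1(\mathcal N,r)$. For every integer $k\ge0$, $$\mathbb E\big[\check\Pi(\{\theta:\|\theta\|_0\ge s_\star+k\}\mid Z)\big]\le\mathbb P[Z\notin\mathcal E]+2e^{a}\Big(4+\frac{4\bar L}{\rho^2}\Big)^{s_\star}\binom d{s_\star}\Big(\frac{4c_2}{d^{c_4}}\Big)^k,$$ where $a=-\frac12\inf_{x>0}\big[r(x)-4\rho\sqrt{s_\star}\,x\big]\in(-\infty,+\infty]$ if $\mathcal N\ne\emptyset$, and $a=0$ if $\mathcal N=\emptyset$. The same bound holds if, in the definition of $\mathcal E$, the event $\mathcal E_0(\mathbb R^d,\rho)$ is replaced by the larger event $\{z:\|\nabla\log q_{\theta_\star}(z)\|_\infty\le\rho/2\}$. (2) Let $\mathcal E=\mathcal E_0(\bar\Theta,\bar\lambda)\cap\hat{\mathcal E}_1(\Theta_\star,\bar L)\cap\check{\mathcal E}_1(\bar\Theta,r)$. For every $M_0>2$, $$\mathbb E\big[\check\Pi(\{\theta\in\theta_\star+\bar\Theta:\|\theta-\theta_\star\|>M_0\bar\epsilon\}\mid Z)\big]\le\mathbb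 P[Z\notin\mathcal E]+\sum_{j\ge1}D_je^{-\frac18r(jM_0\bar\epsilon/2)}+2\binom d{s_\star}\Big(\frac{d^{c_3}}{c_1}\Big)^{s_\star}\Big(1+\frac{\bar L}{\rho^2}\Big)^{s_\star}\sum_{j\ge1}e^{-\frac18r(jM_0\bar\epsilon/2)}e^{3\rho c_0jM_0\bar\epsilon},$$ where $D_j$ is the maximal number of points of $\{\theta\in\theta_\star+\bar\Theta:\|\theta-\theta_\star\|\le(j+1)M_0\bar\epsilon\}$ with pairwise distances at least $jM_0\bar\epsilon/2$, and $c_0=\sup_{u\in\bar\Theta}\sup_{v\in\bar\Theta,\|v\|=1}|\langle\operatorname{sign}(u),v\rangle|$ (sign taken coordinatewise). The right-hand sides may be $+\infty$. -/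

import Mathlib

open MeasureTheory Filter Topology
open scoped ENNReal

noncomputable section

namespace QuasiPosterior

/-- The parameter space `ℝ^d` with its Euclidean structure. -/
abbrev Param (d : ℕ) := EuclideanSpace ℝ (Fin d)

variable {d : ℕ} {X : Type*}

/-- The sparsity structure of `θ`: the set of coordinates where `θ` does not vanish. Elements of
`{0,1}^d` are represented throughout by the subset of coordinates where they equal `1`. -/
def sparsity (θ : Param d) : Finset (Fin d) :=
  Finset.univ.filter fun j => θ j ≠ 0

/-- `‖θ‖₀`, the number of nonzero coordinates. -/
def l0 (θ : Param d) : ℕ := (sparsity θ).card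

/-! ### The prior and the quasi-posterior -/

/-- The Laplace distribution on `ℝ` with density `(ρ/2) exp(-ρ|x|)`. -/
def laplace (ρ : ℝ) : Measure ℝ :=
  volume.withDensity fun x => ENNReal.ofReal (ρ / 2 * Real.exp (-ρ * |x|))

/-- The conditional prior `Π(dθ|δ)`: independent coordinates, Laplace on `δ`, Dirac at `0` off
`δ`. -/
def condPrior (ρ : ℝ) (δ : Finset (Fin d)) : Measure (Param d) :=
  (Measure.pi fun j : Fin d => if j ∈ δ then laplace ρ else Measure.dirac (0 : ℝ)).map
    (WithLp.toLp 2)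

/-- The spike-and-slab prior `Π(dθ) = ∑_δ π_δ Π(dθ|δ)`. -/
def prior (p : Finset (Fin d) → ℝ) (ρ : ℝ) : Measure (Param d) :=
  ∑ δ : Finset (Fin d), ENNReal.ofReal (p δ) • condPrior ρ δ

/-- The quasi-posterior `A ↦ ∫_A q_θ(z) Π(dθ) / ∫ q_θ(z) Π(dθ)`. -/
def quasiPosterior (Pr : Measure (Param d)) (q : Param d → X → ℝ) (z : X) :
    Measure (Param d) :=
  (∫⁻ θ, ENNReal.ofReal (q θ z) ∂Pr)⁻¹ •
    Pr.withDensity fun θ => ENNReal.ofReal (q θ z)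

/-- The law `P_θ(dz) = f_θ(z) dz`, with `ν` the reference measure `dz`. -/
def law [MeasurableSpace X] (ν : Measure X) (f : Param d → X → ℝ) (θ : Param d) : Measure X :=
  ν.withDensity fun z => ENNReal.ofReal (f θ z)

/-- `f θ` is a probability density with respect to `ν`, for every `θ`. -/
def IsDensityFamily [MeasurableSpace X] (ν : Measure X) (f : Param d → X → ℝ) : Prop :=
  ∀ θ, Measurable (f θ) ∧ (∀ z, 0 ≤ f θ z) ∧ ∫⁻ z, ENNReal.ofReal (f θ z) ∂ν = 1

/-- `q` is an admissible quasi-likelihood for the prior `Pr`: positive, jointly measurable, with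
positive and finite normalizing constant for almost every `z`. -/
structure IsQuasiLikelihood [MeasurableSpace X] (ν : Measure X) (Pr : Measure (Param d))
    (q : Param d → X → ℝ) : Prop where
  pos : ∀ θ z, 0 < q θ z
  measurable : Measurable fun w : Param d × X => q w.1 w.2
  normalizable : ∀ᵐ z ∂ν, 0 < ∫⁻ θ, ENNReal.ofReal (q θ z) ∂Pr ∧
    ∫⁻ θ, ENNReal.ofReal (q θ z) ∂Pr < ∞

/-- For every `z`, the map `θ ↦ log q_θ(z)` is concave and differentiable. -/
def IsLogConcaveSmooth (q : Param d → X → ℝ) : Prop :=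
  ∀ z, ConcaveOn ℝ Set.univ (fun θ => Real.log (q θ z)) ∧
    Differentiable ℝ fun θ => Real.log (q θ z)

/-- The condition on the prior weights: `π_δ = g_{‖δ‖₀} / C(d, ‖δ‖₀)` for a probability
distribution `g` on `{0, …, d}` with `c₁ d^{-c₃} g_{s-1} ≤ g_s ≤ c₂ d^{-c₄} g_{s-1}`. -/
structure IsSparsePrior (p : Finset (Fin d) → ℝ) (g : ℕ → ℝ) (c₁ c₂ c₃ c₄ : ℝ) : Prop where
  c₁_pos : 0 < c₁
  c₂_pos : 0 < c₂
  c₄_pos : 0 < c₄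
  c₄_le : c₄ ≤ c₃
  nonneg : ∀ s ≤ d, 0 ≤ g s
  sum_one : ∑ s ∈ Finset.range (d + 1), g s = 1
  weight : ∀ δ, p δ = g δ.card / (d.choose δ.card : ℝ)
  lower : ∀ s, 1 ≤ s → s ≤ d → c₁ / (d : ℝ) ^ c₃ * g (s - 1) ≤ g s
  upper : ∀ s, 1 ≤ s → s ≤ d → g s ≤ c₂ / (d : ℝ) ^ c₄ * g (s - 1)

/-! ### Curvature, rate functions, cones -/

/-- `∇ log q_{θ⋆}(z)`. -/
def score (q : Param d → X → ℝ) (θs : Param d) (z : X) : Param d :=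
  gradient (fun θ => Real.log (q θ z)) θs

/-- `L_θ(z) = log q_θ(z) - log q_{θ⋆}(z) - ⟨∇ log q_{θ⋆}(z), θ - θ⋆⟩`. -/
def bregman (q : Param d → X → ℝ) (θs θ : Param d) (z : X) : ℝ :=
  Real.log (q θ z) - Real.log (q θs z) - inner ℝ (score q θs z) (θ - θs)

/-- Rate functions; only the values of `r` on `[0, ∞)` matter. -/
structure IsRateFunction (r : ℝ → ℝ) : Prop where
  continuousOn : ContinuousOn r (Set.Ici 0)
  strictMonoOn : StrictMonoOn r (Set.Ici 0)
  zero : r 0 = 0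
  tendsto : Tendsto (fun x => r x / x) (𝓝[>] 0) (𝓝 0)

/-- `φ_r(a) = inf {x > 0 : r(z) ≥ a z for all z ≥ x}`, equal to `∞` if the set is empty. -/
def rateInv (r : ℝ → ℝ) (a : ℝ) : ℝ≥0∞ :=
  ⨅ (x : ℝ) (_ : 0 < x ∧ ∀ z, x ≤ z → a * z ≤ r z), ENNReal.ofReal x

/-- Split cones: nonempty cones that are invariant under all changes of signs of coordinates. -/
structure IsSplitCone (Θ : Set (Param d)) : Prop where
  nonempty : Θ.Nonempty
  smul_mem : ∀ t : ℝ, 0 ≤ t → ∀ x ∈ Θ, t • x ∈ Θ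
  sign_mem : ∀ u : Fin d → ℝ, (∀ j, u j = 1 ∨ u j = -1) →
    ∀ x ∈ Θ, WithLp.toLp 2 (fun j => u j * x j) ∈ Θ

/-- `Θ⋆`, the vectors that vanish wherever `θ⋆` vanishes. -/
def starCone (θs : Param d) : Set (Param d) :=
  {θ | ∀ j, θs j = 0 → θ j = 0}

/-- The set `𝒩` of nonzero `θ` with `∑_{j ∉ supp θ⋆} |θ_j| ≤ 7 ∑_{j ∈ supp θ⋆} |θ_j|`. -/
def coneN (θs : Param d) : Set (Param d) :=
  {θ | θ ≠ 0 ∧ ∑ j ∈ (sparsity θs)ᶜ, |θ j| ≤ 7 * ∑ j ∈ sparsity θs, |θ j|}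

/-! ### Good events -/

/-- `Ě₁(Θ, r)`. -/
def eventUpper (q : Param d → X → ℝ) (θs : Param d) (Θ : Set (Param d)) (r : ℝ → ℝ) : Set X :=
  {z | ∀ v ∈ Θ, bregman q θs (θs + v) z ≤ -(1 / 2) * r ‖v‖}

/-- `Ê₁(Θ, L)`. -/
def eventLower (q : Param d → X → ℝ) (θs : Param d) (Θ : Set (Param d)) (L : ℝ) : Set X :=
  {z | ∀ v ∈ Θ, -(L / 2) * ‖v‖ ^ 2 ≤ bregman q θs (θs + v) z}

/-- `E₀(Θ, lam)`: `|⟨∇ log q_{θ⋆}(z), u⟩| ≤ lam/2` for all unit vectors `u` of `Θ`. -/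
def eventScore (q : Param d → X → ℝ) (θs : Param d) (Θ : Set (Param d)) (lam : ℝ) : Set X :=
  {z | ∀ u ∈ Θ, ‖u‖ = 1 → |inner ℝ (score q θs z) u| ≤ lam / 2}

/-- `{z : ‖∇ log q_{θ⋆}(z)‖_∞ ≤ lam/2}`. -/
def eventScoreSup (q : Param d → X → ℝ) (θs : Param d) (lam : ℝ) : Set X :=
  {z | ∀ j, |score q θs z j| ≤ lam / 2}

/-! ### Quantities in the bounds -/

/-- `B(Θ, M) = {θ ∈ θ⋆ + Θ : ‖θ - θ⋆‖ ≤ M}`. -/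
def coneBall (θs : Param d) (Θ : Set (Param d)) (M : ℝ) : Set (Param d) :=
  {θ | θ - θs ∈ Θ ∧ ‖θ - θs‖ ≤ M}

/-- The `ε`-packing number: the maximal number of points of `B` with pairwise distances at least
`ε`. -/
def packing (ε : ℝ) (B : Set (Param d)) : ℕ∞ :=
  ⨆ (F : Finset (Param d)) (_ : (F : Set (Param d)) ⊆ B ∧
    (F : Set (Param d)).Pairwise fun x y => ε ≤ dist x y), (F.card : ℕ∞)

/-- `a = -(1/2) inf_{x > 0} [r(x) - 4 ρ √s⋆ x]` if `𝒩 ≠ ∅`, and `a = 0` otherwise. The infimum may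
be `-∞`, and then `a = +∞`. -/
def expoA (θs : Param d) (ρ : ℝ) (r : ℝ → ℝ) : EReal :=
  open Classical in
  if (coneN θs).Nonempty then
    ((-(1 / 2) : ℝ) : EReal) *
      ⨅ (x : ℝ) (_ : 0 < x), ((r x - 4 * ρ * Real.sqrt (l0 θs) * x : ℝ) : EReal)
  else 0

/-- `c₀ = sup_{u ∈ Θ} sup_{v ∈ Θ, ‖v‖ = 1} |⟨sign u, v⟩|`; the set is bounded by `√d`. -/
def coneConst (Θ : Set (Param d)) : ℝ :=
  sSup {t | ∃ u ∈ Θ, ∃ v ∈ Θ, ‖v‖ = 1 ∧ t = |∑ j, Real.sign (u j) * v j|}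

end QuasiPosterior

end

/-!
The normalizing constant is bounded below by the contribution of the single model `δ = supp θ⋆`:
there the quadratic lower bound on the log-likelihood factorizes over the coordinates, and each
factor is bounded below whatever the score is, because a linear tilt of a symmetric density
multiplies it by `cosh ≥ 1`. In the numerator one divides out the Laplace density, which leaves
Lebesgue measure, and keeps the factor `exp (-a‖θ - θ⋆‖₁)`, which integrates to `(ρ/a)^|δ|` over the
model `δ` after recentering at `θ⋆`. Since the weights `g` decay geometrically, summing over the
models gives a geometric series.

What remains is a pointwise bound on the rest of the numerator. For sparsity, the `ℓ¹` penalty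
absorbs the score off the cone `𝒩`, while on `𝒩` the part of `θ - θ⋆` on the support of `θ⋆`
matters, whose `ℓ¹` norm is at most `√s⋆ ‖θ - θ⋆‖`, and the curvature `r` takes over. For
contraction, the curvature absorbs the score beyond the radius `φ_r(2λ)` and
`‖θ - θ⋆‖₁ ≤ c₀ ‖θ - θ⋆‖`; comparing with the values on the shells `(jR, (j+1)R]` gives the series.
The curvature bound holds pointwise on the good event, so no test functions are involved and the
packing numbers do not enter.
-/

namespace QuasiPosterior

section Measure

lemma lintegral_fintype_prod_eq_prod {ι : Type*} [Fintype ι] {Ω : ι → Type*}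
    [∀ i, MeasurableSpace (Ω i)] (μ : ∀ i, Measure (Ω i)) [∀ i, IsProbabilityMeasure (μ i)]
    {F : ∀ i, Ω i → ℝ≥0∞} (hF : ∀ i, Measurable (F i)) :
    ∫⁻ x, ∏ i, F i (x i) ∂Measure.pi μ = ∏ i, ∫⁻ x, F i x ∂μ i := by
  have hind := ProbabilityTheory.iIndepFun_pi (μ := μ) (X := F) fun i => (hF i).aemeasurable
  rw [ProbabilityTheory.lintegral_prod_eq_prod_lintegral_of_indepFun Finset.univ
    (fun i (x : ∀ i, Ω i) => F i (x i)) hind fun i => (hF i).comp (measurable_pi_apply i)]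
  exact Finset.prod_congr rfl fun i _ => (measurePreserving_eval μ i).lintegral_comp (hF i)

lemma lintegral_le_measure_compl_add {Ω : Type*} [MeasurableSpace Ω] (P : Measure Ω)
    [IsProbabilityMeasure P] {F : Ω → ℝ≥0∞} (hF : ∀ ω, F ω ≤ 1) {E : Set Ω} {B : ℝ≥0∞}
    (hB : ∀ ω ∈ E, F ω ≤ B) : ∫⁻ ω, F ω ∂P ≤ P Eᶜ + B := by
  set T := toMeasurable P Eᶜ
  have hT : MeasurableSet T := measurableSet_toMeasurable P Eᶜ
  have hle : ∀ ω, F ω ≤ T.indicator 1 ω + B := by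
    intro ω
    by_cases hω : ω ∈ E
    · exact (hB ω hω).trans le_add_self
    · have hωT : ω ∈ T := subset_toMeasurable P Eᶜ hω
      simpa [hωT] using (hF ω).trans le_self_add
  calc ∫⁻ ω, F ω ∂P ≤ ∫⁻ ω, (T.indicator 1 ω + B) ∂P := lintegral_mono hle
    _ = P Eᶜ + B := by
        rw [lintegral_add_right _ measurable_const, lintegral_indicator_one hT,
          measure_toMeasurable, lintegral_const, measure_univ, mul_one]

lemma lintegral_eq_lintegral_Ioi_add_comp_neg {F : ℝ → ℝ≥0∞} (hF : Measurable F) :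
    ∫⁻ x, F x = ∫⁻ x in Set.Ioi 0, (F x + F (-x)) := by
  have hneg : ∫⁻ x in Set.Iic 0, F x = ∫⁻ x in Set.Ioi 0, F (-x) := by
    rw [← (Measure.measurePreserving_neg volume).setLIntegral_comp_preimage measurableSet_Iic hF,
      Set.neg_preimage, Set.neg_Iic, neg_zero]
    exact setLIntegral_congr Ioi_ae_eq_Ici.symm
  rw [lintegral_add_left hF, ← hneg, ← Set.compl_Ioi, lintegral_add_compl _ measurableSet_Ioi]

end Measure

lemma sub_le_of_concaveOn_of_hasFDerivAt {E : Type*} [NormedAddCommGroup E] [NormedSpace ℝ E]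
    {S : Set E} {f : E → ℝ} {f' : E →L[ℝ] ℝ} {x y : E} (hf : ConcaveOn ℝ S f) (hx : x ∈ S)
    (hy : y ∈ S) (hf' : HasFDerivAt f f' x) : f y - f x ≤ f' (y - x) := by
  let line : ℝ →ᵃ[ℝ] E := AffineMap.lineMap x y
  have hline0 : line 0 = x := AffineMap.lineMap_apply_zero x y
  have hline1 : line 1 = y := AffineMap.lineMap_apply_one x y
  have hderiv : HasDerivAt (f ∘ line) (f' (y - x)) 0 :=
    HasFDerivAt.comp_hasDerivAt 0 (by rwa [hline0]) AffineMap.hasDerivAt_lineMap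
  have hslope := (hf.comp_affineMap line).slope_le_of_hasDerivAt
    (x := 0) (y := 1) (by rwa [Set.mem_preimage, hline0]) (by rwa [Set.mem_preimage, hline1])
    one_pos hderiv
  simpa [slope_def_field, hline0, hline1] using hslope

lemma exists_pnat_mul_lt_and_le_add_one_mul {R x : ℝ} (hR : 0 < R) (hx : R < x) :
    ∃ j : ℕ+, j * R < x ∧ x ≤ (j + 1) * R := by
  have hceil : 1 < ⌈x / R⌉₊ := Nat.lt_ceil.2 (by rwa [Nat.cast_one, one_lt_div hR])
  refine ⟨⟨⌈x / R⌉₊ - 1, by omega⟩, ?_, ?_⟩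
  · exact (lt_div_iff₀ hR).1 (Nat.lt_ceil.1 (Nat.sub_lt (by omega) one_pos))
  · rw [PNat.mk_coe, Nat.cast_sub hceil.le, Nat.cast_one, sub_add_cancel, ← div_le_iff₀ hR]
    exact Nat.le_ceil (x / R)

lemma sum_abs_le_sqrt_card_mul_norm {ι : Type*} [Fintype ι] (S : Finset ι)
    (v : EuclideanSpace ℝ ι) : ∑ j ∈ S, |v j| ≤ √S.card * ‖v‖ := by
  refine abs_le_of_sq_le_sq' ?_ (by positivity) |>.2
  rw [mul_pow, Real.sq_sqrt (Nat.cast_nonneg _), EuclideanSpace.real_norm_sq_eq]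
  calc (∑ j ∈ S, |v j|) ^ 2 ≤ S.card * ∑ j ∈ S, |v j| ^ 2 := sq_sum_le_card_mul_sum_sq
    _ ≤ S.card * ∑ j, v j ^ 2 := by
        simp_rw [sq_abs]
        gcongr
        exact Finset.subset_univ S

section Laplace

variable {ρ : ℝ}

lemma lintegral_exp_neg_mul_abs {a : ℝ} (ha : 0 < a) :
    ∫⁻ x : ℝ, ENNReal.ofReal (Real.exp (-a * |x|)) = ENNReal.ofReal (2 / a) := by
  have h : ∫ x : ℝ, Real.exp (-a * |x|) = 2 / a := by
    rw [integral_comp_abs (f := fun x => Real.exp (-a * x)),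
      integral_exp_mul_Ioi (neg_lt_zero.2 ha) 0]
    simp [div_eq_mul_inv]
  have hint : Integrable fun x : ℝ => Real.exp (-a * |x|) :=
    .of_integral_ne_zero (by rw [h]; positivity)
  rw [← h, ofReal_integral_eq_lintegral_ofReal hint (Eventually.of_forall fun x => by positivity)]

lemma lintegral_laplace (ρ : ℝ) {F : ℝ → ℝ≥0∞} (hF : Measurable F) :
    ∫⁻ x, F x ∂laplace ρ = ∫⁻ x, ENNReal.ofReal (ρ / 2 * Real.exp (-ρ * |x|)) * F x :=
  lintegral_withDensity_eq_lintegral_mul _ (by fun_prop) hF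

lemma lintegral_laplace_exp_tilt (ρ : ℝ) {a : ℝ} (ha : 0 < a) (m : ℝ) :
    ∫⁻ x, ENNReal.ofReal (Real.exp (ρ * |x| - a * |x - m|)) ∂laplace ρ =
      ENNReal.ofReal (ρ / a) := by
  have hcancel : ∀ x : ℝ, ENNReal.ofReal (ρ / 2 * Real.exp (-ρ * |x|)) *
      ENNReal.ofReal (Real.exp (ρ * |x| - a * |x - m|)) =
      ENNReal.ofReal (ρ / 2) * ENNReal.ofReal (Real.exp (-a * |x - m|)) := by
    intro x
    rw [← ENNReal.ofReal_mul' (by positivity), ← ENNReal.ofReal_mul' (by positivity), mul_assoc,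
      ← Real.exp_add]
    ring_nf
  rw [lintegral_laplace ρ (by fun_prop)]
  simp_rw [hcancel]
  rw [lintegral_const_mul _ (by fun_prop),
    lintegral_sub_right_eq_self (fun x => ENNReal.ofReal (Real.exp (-a * |x|))) m,
    lintegral_exp_neg_mul_abs ha, ← ENNReal.ofReal_mul' (by positivity)]
  congr 1
  field_simp

lemma isProbabilityMeasure_laplace (hρ : 0 < ρ) : IsProbabilityMeasure (laplace ρ) where
  measure_univ := by simpa [hρ.ne'] using lintegral_laplace_exp_tilt ρ hρ 0

lemma ofReal_exp_mul_lintegral_laplace_le (hρ : 0 ≤ ρ) {F : ℝ → ℝ≥0∞} (hF : Measurable F)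
    (m : ℝ) :
    ENNReal.ofReal (Real.exp (-ρ * |m|)) * ∫⁻ x, F x ∂laplace ρ ≤
      ∫⁻ x, F (x - m) ∂laplace ρ := by
  rw [lintegral_laplace ρ hF, lintegral_laplace ρ (by fun_prop),
    ← lintegral_const_mul _ (by fun_prop), ← lintegral_sub_right_eq_self _ m]
  refine lintegral_mono fun x => ?_
  simp only
  rw [← mul_assoc, ← ENNReal.ofReal_mul (by positivity)]
  refine mul_le_mul_left (ENNReal.ofReal_le_ofReal ?_) _
  rw [mul_left_comm, ← Real.exp_add, ← mul_add]
  have htriangle : |x| ≤ |m| + |x - m| := by simpa using abs_add_le m (x - m)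
  gcongr ρ / 2 * Real.exp ?_
  exact mul_le_mul_of_nonpos_left htriangle (neg_nonpos.2 hρ)

lemma hasDerivAt_neg_exp_div {L x : ℝ} (hx : ρ + L * x ≠ 0) :
    HasDerivAt (fun x => -(Real.exp (-ρ * x - L / 2 * x ^ 2) / (ρ + L * x)))
      ((1 + L / (ρ + L * x) ^ 2) * Real.exp (-ρ * x - L / 2 * x ^ 2)) x := by
  have hquad : HasDerivAt (fun x => -ρ * x - L / 2 * x ^ 2) (-(ρ + L * x)) x := by
    refine (((hasDerivAt_id x).const_mul (-ρ)).sub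
      ((hasDerivAt_pow 2 x).const_mul (L / 2))).congr_deriv ?_
    push_cast
    ring
  have hlin : HasDerivAt (fun x => ρ + L * x) L x := by
    simpa using ((hasDerivAt_id x).const_mul L).const_add ρ
  refine (hquad.exp.div hlin hx).neg.congr_deriv ?_
  generalize ρ + L * x = u at hx
  field_simp
  ring

lemma tendsto_exp_div_atTop {L : ℝ} (hρ : 0 < ρ) (hL : 0 ≤ L) :
    Tendsto (fun x => Real.exp (-ρ * x - L / 2 * x ^ 2) / (ρ + L * x)) atTop (𝓝 0) := by
  have hexp : Tendsto (fun x => Real.exp (-ρ * x) / ρ) atTop (𝓝 0) := by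
    simpa using (Real.tendsto_exp_atBot.comp
      (tendsto_id.const_mul_atTop_of_neg (neg_lt_zero.2 hρ))).div_const ρ
  refine squeeze_zero' ?_ ?_ hexp
  · filter_upwards [eventually_ge_atTop 0] with x hx
    positivity
  · filter_upwards [eventually_ge_atTop 0] with x hx
    gcongr
    · exact sub_le_self _ (by positivity)
    · exact le_add_of_nonneg_right (by positivity)

-- Mills bound: with `u x = ρ x + L x² / 2` and `w = ρ + L x` its derivative, `-exp (-u) / w` has
-- derivative `(1 + L / w ^ 2) exp (-u) ≤ (1 + L / ρ ^ 2) exp (-u)`, as `ρ ≤ w` on the half-line.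
lemma le_lintegral_Ioi_exp_neg_sq {L : ℝ} (hρ : 0 < ρ) (hL : 0 ≤ L) :
    ENNReal.ofReal (1 + L / ρ ^ 2)⁻¹ ≤
      ∫⁻ x in Set.Ioi (0 : ℝ), ENNReal.ofReal (ρ * Real.exp (-ρ * x - L / 2 * x ^ 2)) := by
  set w : ℝ → ℝ := fun x => Real.exp (-ρ * x - L / 2 * x ^ 2)
  set A : ℝ := (1 + L / ρ ^ 2)⁻¹ with hA
  have hden : ∀ x ∈ Set.Ici (0 : ℝ), 0 < ρ + L * x := by
    rintro x (hx : 0 ≤ x)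
    positivity
  have hderiv := fun x hx => hasDerivAt_neg_exp_div (hden x hx).ne'
  have hnonneg : ∀ x ∈ Set.Ioi (0 : ℝ), 0 ≤ (1 + L / (ρ + L * x) ^ 2) * w x := fun x _ => by
    positivity
  have hlim : Tendsto (fun x => -(w x / (ρ + L * x))) atTop (𝓝 0) := by
    simpa only [neg_zero] using (tendsto_exp_div_atTop hρ hL).neg
  have hint : ∫ x in Set.Ioi (0 : ℝ), (1 + L / (ρ + L * x) ^ 2) * w x = 1 / ρ := by
    rw [integral_Ioi_of_hasDerivAt_of_nonneg' hderiv hnonneg hlim]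
    simp
  calc ENNReal.ofReal A = ENNReal.ofReal (ρ * A) * ENNReal.ofReal (1 / ρ) := by
        rw [← ENNReal.ofReal_mul (by positivity)]
        field_simp
    _ = ∫⁻ x in Set.Ioi (0 : ℝ),
          ENNReal.ofReal (ρ * A) * ENNReal.ofReal ((1 + L / (ρ + L * x) ^ 2) * w x) := by
        rw [← hint, ofReal_integral_eq_lintegral_ofReal
          (integrableOn_Ioi_deriv_of_nonneg' hderiv hnonneg hlim)
          (ae_restrict_of_forall_mem measurableSet_Ioi hnonneg),
          lintegral_const_mul _ (by fun_prop)]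
    _ ≤ _ := by
        refine setLIntegral_mono (by fun_prop) fun x hx => ?_
        rw [← ENNReal.ofReal_mul (by positivity), mul_assoc, ← mul_assoc A]
        have hx0 : 0 ≤ L * x := mul_nonneg hL (Set.mem_Ioi.1 hx).le
        have hle : A * (1 + L / (ρ + L * x) ^ 2) ≤ 1 := by
          rw [hA, inv_mul_le_one₀ (by positivity)]
          gcongr
          exact le_add_of_nonneg_right hx0
        gcongr
        exact mul_le_of_le_one_left (Real.exp_nonneg _) hle

lemma le_lintegral_laplace_exp_sub_sq {L : ℝ} (hρ : 0 < ρ) (hL : 0 ≤ L) (b : ℝ) :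
    ENNReal.ofReal (1 + L / ρ ^ 2)⁻¹ ≤
      ∫⁻ x, ENNReal.ofReal (Real.exp (b * x - L / 2 * x ^ 2)) ∂laplace ρ := by
  rw [lintegral_laplace ρ (by fun_prop), lintegral_eq_lintegral_Ioi_add_comp_neg (by fun_prop)]
  refine (le_lintegral_Ioi_exp_neg_sq hρ hL).trans (setLIntegral_mono (by fun_prop) fun x hx => ?_)
  have hx0 : |x| = x := abs_of_pos hx
  have hsum : ρ / 2 * Real.exp (-ρ * |x|) * Real.exp (b * x - L / 2 * x ^ 2) +
      ρ / 2 * Real.exp (-ρ * |-x|) * Real.exp (b * -x - L / 2 * (-x) ^ 2) =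
      ρ * Real.exp (-ρ * x - L / 2 * x ^ 2) * Real.cosh (b * x) := by
    simp only [abs_neg, hx0, Real.cosh_eq, mul_assoc, ← Real.exp_add, mul_div_assoc', mul_add]
    ring_nf
  rw [← ENNReal.ofReal_mul (by positivity), ← ENNReal.ofReal_mul (by positivity),
    ← ENNReal.ofReal_add (by positivity) (by positivity), hsum]
  exact ENNReal.ofReal_le_ofReal (le_mul_of_one_le_right (by positivity) (Real.one_le_cosh _))

lemma le_lintegral_laplace_exp_sub_sq_comp_sub {L : ℝ} (hρ : 0 < ρ) (hL : 0 ≤ L) (b m : ℝ) :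
    ENNReal.ofReal (Real.exp (-ρ * |m|) * (1 + L / ρ ^ 2)⁻¹) ≤
      ∫⁻ x, ENNReal.ofReal (Real.exp (b * (x - m) - L / 2 * (x - m) ^ 2)) ∂laplace ρ := by
  rw [ENNReal.ofReal_mul (by positivity)]
  exact (mul_le_mul_right (le_lintegral_laplace_exp_sub_sq hρ hL b) _).trans
    (ofReal_exp_mul_lintegral_laplace_le hρ.le
      (F := fun x => ENNReal.ofReal (Real.exp (b * x - L / 2 * x ^ 2))) (by fun_prop) m)

end Laplace

section Parameters

variable {d : ℕ}

/-- The `ℓ¹` norm of a parameter; the norm of `Param d` is the Euclidean one. -/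
noncomputable def l1 (θ : Param d) : ℝ := ∑ j, |θ j|

@[fun_prop]
lemma measurable_l1 : Measurable (l1 : Param d → ℝ) := by
  unfold l1
  fun_prop

lemma notMem_sparsity {θ : Param d} {j : Fin d} : j ∉ sparsity θ ↔ θ j = 0 := by
  simp [sparsity]

lemma l0_le (θ : Param d) : l0 θ ≤ d := by
  simpa [l0] using (sparsity θ).card_le_univ

lemma l0_le_card {δ : Finset (Fin d)} {θ : Param d} (h : ∀ j ∉ δ, θ j = 0) :
    l0 θ ≤ δ.card :=
  Finset.card_le_card fun j hj => not_imp_comm.1 (h j) (Finset.mem_filter.1 hj).2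

lemma l1_eq_sum_add_sum_compl (S : Finset (Fin d)) (v : Param d) :
    l1 v = ∑ j ∈ S, |v j| + ∑ j ∈ Sᶜ, |v j| :=
  (Finset.sum_add_sum_compl S _).symm

lemma l1_eq_sum_sparsity (θ : Param d) : l1 θ = ∑ j ∈ sparsity θ, |θ j| :=
  (Finset.sum_subset (Finset.subset_univ _) fun j _ hj => by
    rw [notMem_sparsity.1 hj, abs_zero]).symm

lemma l1_sub_l1_le (θs θ : Param d) :
    l1 θs - l1 θ ≤ ∑ j ∈ sparsity θs, |(θ - θs) j| - ∑ j ∈ (sparsity θs)ᶜ, |(θ - θs) j| := by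
  have hon : ∀ j ∈ sparsity θs, |θs j| ≤ |θ j| + |(θ - θs) j| := fun j _ => by
    simpa [abs_sub_comm] using abs_add_le (θ j) (θs j - θ j)
  have hoff : ∑ j ∈ (sparsity θs)ᶜ, |(θ - θs) j| = ∑ j ∈ (sparsity θs)ᶜ, |θ j| :=
    Finset.sum_congr rfl fun j hj => by
      rw [PiLp.sub_apply, notMem_sparsity.1 (Finset.mem_compl.1 hj), sub_zero]
  have hsum := Finset.sum_le_sum hon
  rw [Finset.sum_add_distrib] at hsum
  rw [l1_eq_sum_sparsity θs, l1_eq_sum_add_sum_compl (sparsity θs) θ, hoff]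
  linarith

lemma l1_sub_l1_le_l1_sub (θs θ : Param d) : l1 θs - l1 θ ≤ l1 (θ - θs) := by
  simp_rw [l1, ← Finset.sum_sub_distrib, PiLp.sub_apply, abs_sub_comm (θ _)]
  exact Finset.sum_le_sum fun j _ => abs_sub_abs_le_abs_sub (θs j) (θ j)

lemma inner_le_mul_l1 {b : Param d} {c : ℝ} (hb : ∀ j, |b j| ≤ c) (v : Param d) :
    inner ℝ b v ≤ c * l1 v := by
  rw [PiLp.inner_apply, l1, Finset.mul_sum]
  refine Finset.sum_le_sum fun j _ => ?_
  calc inner ℝ (b j) (v j) ≤ |b j| * |v j| := real_inner_le_norm (b j) (v j)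
    _ ≤ c * |v j| := by gcongr; exact hb j

end Parameters

section ConditionalPrior

variable {d : ℕ} {ρ : ℝ}

lemma isProbabilityMeasure_ite_laplace_dirac (hρ : 0 < ρ) (δ : Finset (Fin d)) (j : Fin d) :
    IsProbabilityMeasure (if j ∈ δ then laplace ρ else Measure.dirac (0 : ℝ)) := by
  split_ifs
  · exact isProbabilityMeasure_laplace hρ
  · infer_instance

lemma isProbabilityMeasure_condPrior (hρ : 0 < ρ) (δ : Finset (Fin d)) :
    IsProbabilityMeasure (condPrior ρ δ) := by
  have := isProbabilityMeasure_ite_laplace_dirac hρ δ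
  exact Measure.isProbabilityMeasure_map (by fun_prop)

lemma lintegral_condPrior_prod (hρ : 0 < ρ) (δ : Finset (Fin d)) {F : Fin d → ℝ → ℝ≥0∞}
    (hF : ∀ j, Measurable (F j)) :
    ∫⁻ θ, ∏ j, F j (θ j) ∂condPrior ρ δ =
      ∏ j, if j ∈ δ then ∫⁻ x, F j x ∂laplace ρ else F j 0 := by
  have := isProbabilityMeasure_ite_laplace_dirac hρ δ
  rw [condPrior, lintegral_map (by fun_prop) (by fun_prop)]
  refine (lintegral_fintype_prod_eq_prod _ hF).trans (Finset.prod_congr rfl fun j _ => ?_)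
  split_ifs
  · rfl
  · exact lintegral_dirac' _ (hF j)

lemma ae_condPrior_eq_zero (hρ : 0 < ρ) (δ : Finset (Fin d)) :
    ∀ᵐ θ ∂condPrior ρ δ, ∀ j ∉ δ, θ j = 0 := by
  have := isProbabilityMeasure_ite_laplace_dirac hρ δ
  refine ae_all_iff.2 fun j => ?_
  by_cases hj : j ∈ δ
  · simp [hj]
  simp only [hj, not_false_eq_true, forall_const]
  rw [condPrior, ae_map_iff (by fun_prop) (measurableSet_eq_fun (by fun_prop) (by fun_prop))]
  refine (measurePreserving_eval
    (fun j : Fin d => if j ∈ δ then laplace ρ else Measure.dirac (0 : ℝ)) j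
    ).quasiMeasurePreserving.ae (p := fun x => x = 0) ?_
  rw [if_neg hj]
  exact (ae_dirac_iff (measurableSet_singleton (0 : ℝ))).2 rfl

lemma lintegral_condPrior_exp_tilt_le (hρ : 0 < ρ) {a : ℝ} (ha : 0 < a) (δ : Finset (Fin d))
    (θs : Param d) :
    ∫⁻ θ, ENNReal.ofReal (Real.exp (ρ * l1 θ - a * l1 (θ - θs))) ∂condPrior ρ δ ≤
      ENNReal.ofReal ((ρ / a) ^ δ.card) := by
  have hfactor : ∀ θ : Param d, ENNReal.ofReal (Real.exp (ρ * l1 θ - a * l1 (θ - θs))) =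
      ∏ j, ENNReal.ofReal (Real.exp (ρ * |θ j| - a * |θ j - θs j|)) := by
    intro θ
    rw [← ENNReal.ofReal_prod_of_nonneg fun j _ => Real.exp_nonneg _, ← Real.exp_sum,
      Finset.sum_sub_distrib, ← Finset.mul_sum, ← Finset.mul_sum]
    rfl
  have hconst : ENNReal.ofReal ((ρ / a) ^ δ.card) =
      ∏ j, if j ∈ δ then ENNReal.ofReal (ρ / a) else 1 := by
    rw [Finset.prod_ite_mem, Finset.univ_inter, Finset.prod_const,
      ENNReal.ofReal_pow (by positivity)]
  simp_rw [hfactor]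
  rw [hconst, lintegral_condPrior_prod hρ δ
    (F := fun j x => ENNReal.ofReal (Real.exp (ρ * |x| - a * |x - θs j|))) (fun j => by fun_prop)]
  refine Finset.prod_le_prod' fun j _ => ?_
  split_ifs
  · exact (lintegral_laplace_exp_tilt ρ ha (θs j)).le
  · rw [ENNReal.ofReal_le_one, Real.exp_le_one_iff, abs_zero, mul_zero, zero_sub, neg_nonpos]
    positivity

lemma le_lintegral_condPrior_exp_sub_sq {L : ℝ} (hρ : 0 < ρ) (hL : 0 ≤ L) (b θs : Param d) :
    ENNReal.ofReal (Real.exp (-ρ * l1 θs) * (1 + L / ρ ^ 2)⁻¹ ^ l0 θs) ≤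
      ∫⁻ θ, ENNReal.ofReal (Real.exp (inner ℝ b (θ - θs) - L / 2 * ‖θ - θs‖ ^ 2))
        ∂condPrior ρ (sparsity θs) := by
  have hfactor : ∀ θ : Param d,
      ENNReal.ofReal (Real.exp (inner ℝ b (θ - θs) - L / 2 * ‖θ - θs‖ ^ 2)) =
      ∏ j, ENNReal.ofReal (Real.exp (b j * (θ j - θs j) - L / 2 * (θ j - θs j) ^ 2)) := by
    intro θ
    rw [← ENNReal.ofReal_prod_of_nonneg fun j _ => Real.exp_nonneg _, ← Real.exp_sum,
      Finset.sum_sub_distrib, ← Finset.mul_sum, EuclideanSpace.real_norm_sq_eq, PiLp.inner_apply]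
    simp [mul_comm]
  have hconst : ENNReal.ofReal (Real.exp (-ρ * l1 θs) * (1 + L / ρ ^ 2)⁻¹ ^ l0 θs) =
      ∏ j, if j ∈ sparsity θs then
        ENNReal.ofReal (Real.exp (-ρ * |θs j|) * (1 + L / ρ ^ 2)⁻¹) else 1 := by
    rw [Finset.prod_ite_mem, Finset.univ_inter,
      ← ENNReal.ofReal_prod_of_nonneg fun j _ => by positivity, Finset.prod_mul_distrib,
      Finset.prod_const, ← Real.exp_sum, ← Finset.mul_sum, ← l1_eq_sum_sparsity, l0]
  simp_rw [hfactor]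
  rw [hconst, lintegral_condPrior_prod hρ (sparsity θs)
    (F := fun j x => ENNReal.ofReal (Real.exp (b j * (x - θs j) - L / 2 * (x - θs j) ^ 2)))
    (fun j => by fun_prop)]
  refine Finset.prod_le_prod' fun j _ => ?_
  split_ifs with hj
  · exact le_lintegral_laplace_exp_sub_sq_comp_sub hρ hL (b j) (θs j)
  · simp [notMem_sparsity.1 hj]

end ConditionalPrior

section Weights

variable {d : ℕ} {p : Finset (Fin d) → ℝ} {g : ℕ → ℝ} {c₁ c₂ c₃ c₄ : ℝ}

lemma IsSparsePrior.ratio_nonneg (H : IsSparsePrior p g c₁ c₂ c₃ c₄) : 0 ≤ c₂ / (d : ℝ) ^ c₄ :=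
  div_nonneg H.c₂_pos.le (by positivity)

lemma IsSparsePrior.apply_add_le (H : IsSparsePrior p g c₁ c₂ c₃ c₄) {s n : ℕ} (h : s + n ≤ d) :
    g (s + n) ≤ (c₂ / (d : ℝ) ^ c₄) ^ n * g s := by
  induction n with
  | zero => simp
  | succ n ih =>
    calc g (s + n + 1) ≤ c₂ / (d : ℝ) ^ c₄ * g (s + n) := H.upper (s + n + 1) (by omega) h
      _ ≤ c₂ / (d : ℝ) ^ c₄ * ((c₂ / (d : ℝ) ^ c₄) ^ n * g s) :=
          mul_le_mul_of_nonneg_left (ih (by omega)) H.ratio_nonneg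
      _ = _ := by rw [pow_succ', mul_assoc]

lemma IsSparsePrior.apply_le_add (H : IsSparsePrior p g c₁ c₂ c₃ c₄) {s n : ℕ} (h : s + n ≤ d) :
    g s ≤ ((d : ℝ) ^ c₃ / c₁) ^ n * g (s + n) := by
  induction n with
  | zero => simp
  | succ n ih =>
    have hd : (0 : ℝ) < d := Nat.cast_pos.2 (by omega)
    have hc := H.c₁_pos
    have hstep : g (s + n) ≤ (d : ℝ) ^ c₃ / c₁ * g (s + n + 1) := by
      have hlower : c₁ / (d : ℝ) ^ c₃ * g (s + n) ≤ g (s + n + 1) :=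
        H.lower (s + n + 1) (by omega) h
      rwa [← inv_div, inv_mul_le_iff₀ (by positivity)] at hlower
    calc g s ≤ ((d : ℝ) ^ c₃ / c₁) ^ n * g (s + n) := ih (by omega)
      _ ≤ ((d : ℝ) ^ c₃ / c₁) ^ n * ((d : ℝ) ^ c₃ / c₁ * g (s + n + 1)) := by gcongr
      _ = _ := by rw [pow_succ, mul_assoc]; rfl

lemma IsSparsePrior.zero_pos (H : IsSparsePrior p g c₁ c₂ c₃ c₄) : 0 < g 0 := by
  refine (H.nonneg 0 (Nat.zero_le d)).lt_of_ne' fun h0 => ?_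
  have hzero : ∀ s ∈ Finset.range (d + 1), g s ≤ 0 := fun s hs => by
    have hs' : 0 + s ≤ d := by simpa [Nat.lt_succ_iff] using hs
    simpa [h0] using H.apply_add_le hs'
  linarith [H.sum_one, Finset.sum_nonpos hzero]

lemma IsSparsePrior.pos (H : IsSparsePrior p g c₁ c₂ c₃ c₄) {s : ℕ} (h : s ≤ d) : 0 < g s := by
  have hc := H.c₁_pos
  have hle : g 0 ≤ ((d : ℝ) ^ c₃ / c₁) ^ s * g s := by
    simpa using H.apply_le_add (s := 0) (n := s) (by rwa [zero_add])
  exact pos_of_mul_pos_right (H.zero_pos.trans_le hle) (by positivity)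

lemma IsSparsePrior.weight_nonneg (H : IsSparsePrior p g c₁ c₂ c₃ c₄) (δ : Finset (Fin d)) :
    0 ≤ p δ := by
  rw [H.weight]
  exact div_nonneg (H.nonneg _ (by simpa using δ.card_le_univ)) (Nat.cast_nonneg _)

lemma IsSparsePrior.sum_Ico_mul_pow_le (H : IsSparsePrior p g c₁ c₂ c₃ c₄) {K : ℝ} (hK : 0 ≤ K)
    (hratio : K * (c₂ / (d : ℝ) ^ c₄) ≤ 1 / 2) {s : ℕ} (k : ℕ) (hs : s ≤ d) :
    ∑ t ∈ Finset.Ico (s + k) (d + 1), g t * K ^ t ≤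
      2 * (g s * K ^ s * (K * (c₂ / (d : ℝ) ^ c₄)) ^ k) := by
  set x := c₂ / (d : ℝ) ^ c₄
  have hx : 0 ≤ x := H.ratio_nonneg
  have hg := H.nonneg s hs
  have hterm : ∀ i ∈ Finset.range (d + 1 - (s + k)), g (s + k + i) * K ^ (s + k + i) ≤
      g s * K ^ s * (K * x) ^ k * (1 / 2) ^ i := by
    intro i hi
    have hi' : s + (k + i) ≤ d := by
      have := Finset.mem_range.1 hi
      omega
    calc g (s + k + i) * K ^ (s + k + i) = g (s + (k + i)) * K ^ (s + (k + i)) := by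
          rw [add_assoc]
      _ ≤ (x ^ (k + i) * g s) * K ^ (s + (k + i)) := by
          gcongr
          exact H.apply_add_le hi'
      _ = g s * K ^ s * (K * x) ^ k * (K * x) ^ i := by ring
      _ ≤ g s * K ^ s * (K * x) ^ k * (1 / 2) ^ i := by gcongr
  rw [Finset.sum_Ico_eq_sum_range]
  calc ∑ i ∈ Finset.range (d + 1 - (s + k)), g (s + k + i) * K ^ (s + k + i)
      ≤ g s * K ^ s * (K * x) ^ k * ∑ i ∈ Finset.range (d + 1 - (s + k)), (1 / 2 : ℝ) ^ i := by
        rw [Finset.mul_sum]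
        exact Finset.sum_le_sum hterm
    _ ≤ g s * K ^ s * (K * x) ^ k * 2 := by
        gcongr
        exact sum_geometric_two_le _
    _ = _ := mul_comm _ _

lemma IsSparsePrior.sum_weight_mul (H : IsSparsePrior p g c₁ c₂ c₃ c₄) (K : ℝ) (m : ℕ) :
    ∑ δ : Finset (Fin d), p δ * (if m ≤ δ.card then K ^ δ.card else 0) =
      ∑ t ∈ Finset.Ico m (d + 1), g t * K ^ t := by
  simp_rw [H.weight]
  rw [← Finset.powerset_univ, Finset.sum_powerset_apply_card
    (fun t => g t / (d.choose t : ℝ) * (if m ≤ t then K ^ t else 0)), Finset.card_univ,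
    Fintype.card_fin, ← Finset.Ico_filter_le_of_left_le (Nat.zero_le m), Finset.sum_filter,
    ← Finset.range_eq_Ico]
  refine Finset.sum_congr rfl fun t ht => ?_
  have hchoose : (d.choose t : ℝ) ≠ 0 :=
    Nat.cast_ne_zero.2 (Nat.choose_pos (by simpa [Nat.lt_succ_iff] using ht)).ne'
  split_ifs
  · rw [nsmul_eq_mul]
    field_simp
  · simp

end Weights

section Prior

variable {d : ℕ} {p : Finset (Fin d) → ℝ} {g : ℕ → ℝ} {ρ c₁ c₂ c₃ c₄ : ℝ}

lemma setLIntegral_prior (p : Finset (Fin d) → ℝ) (ρ : ℝ) (A : Set (Param d))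
    (F : Param d → ℝ≥0∞) :
    ∫⁻ θ in A, F θ ∂prior p ρ = ∑ δ, ENNReal.ofReal (p δ) * ∫⁻ θ in A, F θ ∂condPrior ρ δ := by
  have hrestrict : (prior p ρ).restrict A =
      ∑ δ : Finset (Fin d), ENNReal.ofReal (p δ) • (condPrior ρ δ).restrict A := by
    rw [prior, ← Measure.restrictₗ_apply, map_sum]
    simp
  rw [hrestrict, lintegral_finsetSum_measure]
  simp_rw [lintegral_smul_measure, smul_eq_mul]

lemma isFiniteMeasure_prior (p : Finset (Fin d) → ℝ) (hρ : 0 < ρ) :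
    IsFiniteMeasure (prior p ρ) := by
  have (δ : Finset (Fin d)) := isProbabilityMeasure_condPrior hρ δ
  have (δ : Finset (Fin d)) : IsFiniteMeasure (ENNReal.ofReal (p δ) • condPrior ρ δ) :=
    Measure.smul_finite _ ENNReal.ofReal_ne_top
  rw [prior]
  infer_instance

lemma setLIntegral_condPrior_le (hρ : 0 < ρ) {a : ℝ} (ha : 0 < a) (θs : Param d)
    {A : Set (Param d)} {m : ℕ} (hA : A ⊆ {θ | m ≤ l0 θ}) {F : Param d → ℝ≥0∞} {C : ℝ≥0∞}
    (hF : ∀ θ ∈ A, F θ ≤ C * ENNReal.ofReal (Real.exp (ρ * l1 θ - a * l1 (θ - θs))))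
    (δ : Finset (Fin d)) :
    ∫⁻ θ in A, F θ ∂condPrior ρ δ ≤
      C * ENNReal.ofReal (if m ≤ δ.card then (ρ / a) ^ δ.card else 0) := by
  split_ifs with hδ
  · calc ∫⁻ θ in A, F θ ∂condPrior ρ δ
        ≤ ∫⁻ θ in A, C * ENNReal.ofReal (Real.exp (ρ * l1 θ - a * l1 (θ - θs)))
            ∂condPrior ρ δ := setLIntegral_mono (by fun_prop) hF
      _ ≤ ∫⁻ θ, C * ENNReal.ofReal (Real.exp (ρ * l1 θ - a * l1 (θ - θs)))
            ∂condPrior ρ δ := setLIntegral_le_lintegral _ _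
      _ = C * ∫⁻ θ, ENNReal.ofReal (Real.exp (ρ * l1 θ - a * l1 (θ - θs)))
            ∂condPrior ρ δ := lintegral_const_mul _ (by fun_prop)
      _ ≤ C * ENNReal.ofReal ((ρ / a) ^ δ.card) := by
          gcongr
          exact lintegral_condPrior_exp_tilt_le hρ ha δ θs
  · have hnull : condPrior ρ δ A = 0 := measure_eq_zero_iff_ae_notMem.2 <|
      (ae_condPrior_eq_zero hρ δ).mono fun θ h hθ => hδ ((hA hθ).trans (l0_le_card h))
    rw [setLIntegral_measure_zero _ _ hnull]
    exact zero_le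

lemma IsSparsePrior.setLIntegral_prior_le (H : IsSparsePrior p g c₁ c₂ c₃ c₄) (hρ : 0 < ρ)
    {a : ℝ} (ha : 0 < a) (θs : Param d) {A : Set (Param d)} {m : ℕ} (hA : A ⊆ {θ | m ≤ l0 θ})
    {F : Param d → ℝ≥0∞} {C : ℝ≥0∞}
    (hF : ∀ θ ∈ A, F θ ≤ C * ENNReal.ofReal (Real.exp (ρ * l1 θ - a * l1 (θ - θs)))) :
    ∫⁻ θ in A, F θ ∂prior p ρ ≤
      C * ENNReal.ofReal (∑ t ∈ Finset.Ico m (d + 1), g t * (ρ / a) ^ t) := by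
  have hnonneg (δ : Finset (Fin d)) :
      0 ≤ p δ * (if m ≤ δ.card then (ρ / a) ^ δ.card else 0) :=
    mul_nonneg (H.weight_nonneg δ) (by split_ifs <;> positivity)
  rw [setLIntegral_prior, ← H.sum_weight_mul, ENNReal.ofReal_sum_of_nonneg fun δ _ => hnonneg δ,
    Finset.mul_sum]
  refine Finset.sum_le_sum fun δ _ => ?_
  rw [ENNReal.ofReal_mul (H.weight_nonneg δ), mul_left_comm]
  gcongr
  exact setLIntegral_condPrior_le hρ ha θs hA hF δ

end Prior

section QuasiLikelihood

variable {d : ℕ} {X : Type*} {q : Param d → X → ℝ} {θs : Param d} {z : X}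

lemma log_sub_log_eq (q : Param d → X → ℝ) (θs θ : Param d) (z : X) :
    Real.log (q θ z) - Real.log (q θs z) =
      inner ℝ (score q θs z) (θ - θs) + bregman q θs θ z := by
  rw [bregman]
  ring

lemma bregman_nonpos (H : IsLogConcaveSmooth q) (θs θ : Param d) (z : X) :
    bregman q θs θ z ≤ 0 := by
  have hle := sub_le_of_concaveOn_of_hasFDerivAt (H z).1 (Set.mem_univ θs) (Set.mem_univ θ)
    ((H z).2 θs).hasGradientAt.hasFDerivAt
  rw [InnerProductSpace.toDual_apply_apply] at hle
  exact sub_nonpos.2 hle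

lemma quasiPosterior_le_one (Pr : Measure (Param d)) (q : Param d → X → ℝ) (z : X)
    (A : Set (Param d)) : quasiPosterior Pr q z A ≤ 1 := by
  refine (measure_mono (Set.subset_univ A)).trans ?_
  rw [quasiPosterior, Measure.smul_apply, withDensity_apply _ MeasurableSet.univ,
    Measure.restrict_univ, smul_eq_mul]
  exact ENNReal.inv_mul_le_one _

lemma le_lintegral_prior {p : Finset (Fin d) → ℝ} {ρ L : ℝ} (hq : ∀ θ, 0 < q θ z) (hρ : 0 < ρ)
    (hL : 0 ≤ L) (hz : z ∈ eventLower q θs (starCone θs) L) :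
    ENNReal.ofReal (p (sparsity θs)) *
      ENNReal.ofReal (q θs z * (Real.exp (-ρ * l1 θs) * (1 + L / ρ ^ 2)⁻¹ ^ l0 θs)) ≤
      ∫⁻ θ, ENNReal.ofReal (q θ z) ∂prior p ρ := by
  have hlik : ∀ θ : Param d, (∀ j ∉ sparsity θs, θ j = 0) → ENNReal.ofReal (q θs z) *
      ENNReal.ofReal (Real.exp (inner ℝ (score q θs z) (θ - θs) - L / 2 * ‖θ - θs‖ ^ 2)) ≤
      ENNReal.ofReal (q θ z) := by
    intro θ hθ
    have hmem : θ - θs ∈ starCone θs := fun j hj => by simp [hθ j (notMem_sparsity.2 hj), hj]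
    have hlower := hz _ hmem
    rw [add_sub_cancel] at hlower
    rw [← ENNReal.ofReal_mul (hq θs).le]
    refine ENNReal.ofReal_le_ofReal ?_
    rw [← Real.log_le_log_iff (by have := hq θs; positivity) (hq θ),
      Real.log_mul (hq θs).ne' (Real.exp_ne_zero _), Real.log_exp]
    linarith [log_sub_log_eq q θs θ z]
  rw [← setLIntegral_univ, setLIntegral_prior]
  refine le_trans ?_ (Finset.single_le_sum (fun _ _ => zero_le) (Finset.mem_univ (sparsity θs)))
  rw [setLIntegral_univ, ENNReal.ofReal_mul (hq θs).le]
  gcongr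
  refine (mul_le_mul_right
    (le_lintegral_condPrior_exp_sub_sq hρ hL (score q θs z) θs) _).trans ?_
  rw [← lintegral_const_mul' _ _ ENNReal.ofReal_ne_top]
  exact lintegral_mono_ae ((ae_condPrior_eq_zero hρ (sparsity θs)).mono hlik)

/-- The log-likelihood ratio of `θ` against `θ⋆`, penalized by `ρ‖·‖₁` as in the slab density, plus
the amount `a‖θ - θ⋆‖₁` that is set aside to make `exp (-a‖θ - θ⋆‖₁)` the integrable factor. -/
noncomputable def excess (q : Param d → X → ℝ) (ρ a : ℝ) (θs θ : Param d) (z : X) : ℝ :=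
  Real.log (q θ z) - Real.log (q θs z) + ρ * (l1 θs - l1 θ) + a * l1 (θ - θs)

lemma ofReal_eq_mul_exp_excess (hq : ∀ θ, 0 < q θ z) (ρ a : ℝ) (θs θ : Param d) :
    ENNReal.ofReal (q θ z) = ENNReal.ofReal (q θs z * Real.exp (-ρ * l1 θs)) *
      ENNReal.ofReal (Real.exp (excess q ρ a θs θ z)) *
      ENNReal.ofReal (Real.exp (ρ * l1 θ - a * l1 (θ - θs))) := by
  have hqs := hq θs
  rw [← ENNReal.ofReal_mul (by positivity), ← ENNReal.ofReal_mul (by positivity), mul_assoc,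
    mul_assoc, ← Real.exp_add, ← Real.exp_add]
  nth_rw 1 [← Real.exp_log (hq θ), ← Real.exp_log hqs]
  rw [← Real.exp_add, excess]
  ring_nf

lemma IsSparsePrior.quasiPosterior_le {p : Finset (Fin d) → ℝ} {g : ℕ → ℝ}
    {c₁ c₂ c₃ c₄ ρ L a : ℝ} (H : IsSparsePrior p g c₁ c₂ c₃ c₄) (hq : ∀ θ, 0 < q θ z)
    (hρ : 0 < ρ) (hL : 0 ≤ L) (ha : 0 < a) (hz : z ∈ eventLower q θs (starCone θs) L)
    {A : Set (Param d)} {m : ℕ} (hA : A ⊆ {θ | m ≤ l0 θ}) {B : ℝ≥0∞}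
    (hB : ∀ θ ∈ A, ENNReal.ofReal (Real.exp (excess q ρ a θs θ z)) ≤ B) :
    quasiPosterior (prior p ρ) q z A ≤ B * ENNReal.ofReal
      (d.choose (l0 θs) / g (l0 θs) * (1 + L / ρ ^ 2) ^ l0 θs *
        ∑ t ∈ Finset.Ico m (d + 1), g t * (ρ / a) ^ t) := by
  have := isFiniteMeasure_prior p hρ
  set c := ENNReal.ofReal (q θs z * Real.exp (-ρ * l1 θs)) with hc
  set T := ∑ t ∈ Finset.Ico m (d + 1), g t * (ρ / a) ^ t
  have hT : 0 ≤ T := Finset.sum_nonneg fun t ht =>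
    mul_nonneg (H.nonneg t (Nat.lt_succ_iff.1 (Finset.mem_Ico.1 ht).2)) (by positivity)
  have hnum : ∫⁻ θ in A, ENNReal.ofReal (q θ z) ∂prior p ρ ≤ c * B * ENNReal.ofReal T := by
    refine H.setLIntegral_prior_le hρ ha θs hA fun θ hθ => ?_
    rw [ofReal_eq_mul_exp_excess hq ρ a θs θ]
    gcongr
    exact hB θ hθ
  rw [quasiPosterior, Measure.smul_apply, withDensity_apply', smul_eq_mul, mul_comm,
    ← div_eq_mul_inv]
  refine ENNReal.div_le_of_le_mul (hnum.trans (le_trans (le_of_eq ?_)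
    (mul_le_mul_right (le_lintegral_prior (p := p) hq hρ hL hz) _)))
  have hqs := hq θs
  have hg := H.pos (l0_le θs)
  have hchoose : (0 : ℝ) < d.choose (l0 θs) := Nat.cast_pos.2 (Nat.choose_pos (l0_le θs))
  have : (1 + L / ρ ^ 2) ^ l0 θs ≠ 0 := by positivity
  rw [mul_comm c, mul_assoc B, mul_assoc B, H.weight, ← l0, hc,
    ← ENNReal.ofReal_mul (by positivity), ← ENNReal.ofReal_mul (by positivity),
    ← ENNReal.ofReal_mul (by positivity), inv_pow]
  congr 2
  field_simp

end QuasiLikelihood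

section Sparsity

variable {d : ℕ} {X : Type*} {q : Param d → X → ℝ} {r : ℝ → ℝ} {θs : Param d} {z : X} {ρ : ℝ}

lemma eventScore_univ_subset (q : Param d → X → ℝ) (θs : Param d) (lam : ℝ) :
    eventScore q θs Set.univ lam ⊆ eventScoreSup q θs lam := by
  intro z hz j
  have hj := hz (EuclideanSpace.single j 1) (Set.mem_univ _) (by simp)
  rw [EuclideanSpace.inner_single_right] at hj
  simpa using hj

-- With `x` and `y` the `ℓ¹` masses of `θ - θ⋆` on and off the support of `θ⋆`, the score costs
-- `ρ/2 (x + y)`, the penalty gains `ρ (y - x)` and `ρ/4 (x + y)` is set aside: this is where the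
-- constant `7` of `𝒩` comes from.
lemma excess_le_bregman_add (hρ : 0 ≤ ρ) (θ : Param d) (hz : z ∈ eventScoreSup q θs ρ) :
    excess q ρ (ρ / 4) θs θ z ≤ bregman q θs θ z + ρ / 4 *
      (7 * ∑ j ∈ sparsity θs, |(θ - θs) j| - ∑ j ∈ (sparsity θs)ᶜ, |(θ - θs) j|) := by
  have hscore := inner_le_mul_l1 hz (θ - θs)
  have hpenalty := mul_le_mul_of_nonneg_left (l1_sub_l1_le θs θ) hρ
  rw [excess, log_sub_log_eq]
  rw [l1_eq_sum_add_sum_compl (sparsity θs) (θ - θs)] at hscore ⊢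
  linarith

lemma coe_le_expoA (hN : (coneN θs).Nonempty) (ρ : ℝ) (r : ℝ → ℝ) {x : ℝ} (hx : 0 < x) :
    ((-(1 / 2) * (r x - 4 * ρ * Real.sqrt (l0 θs) * x) : ℝ) : EReal) ≤ expoA θs ρ r := by
  rw [expoA, if_pos hN, EReal.coe_mul, EReal.coe_neg, EReal.neg_mul, EReal.neg_mul,
    EReal.neg_le_neg_iff]
  exact mul_le_mul_of_nonneg_left (iInf₂_le x hx) (by norm_num)

lemma expoA_nonneg (θs : Param d) (ρ : ℝ) (hr : Tendsto r (𝓝[>] 0) (𝓝 0)) :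
    0 ≤ expoA θs ρ r := by
  by_cases hN : (coneN θs).Nonempty
  · have hlin : Tendsto (fun x : ℝ => 4 * ρ * Real.sqrt (l0 θs) * x) (𝓝[>] 0) (𝓝 0) := by
      have hcont : Continuous fun x : ℝ => 4 * ρ * Real.sqrt (l0 θs) * x := by fun_prop
      simpa using (hcont.tendsto 0).mono_left nhdsWithin_le_nhds
    have hlim := (hr.sub hlin).const_mul (-(1 / 2))
    rw [sub_zero, mul_zero] at hlim
    refine le_of_tendsto ((continuous_coe_real_ereal.tendsto 0).comp hlim) ?_
    exact eventually_mem_nhdsWithin.mono fun x hx => coe_le_expoA hN ρ r hx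
  · rw [expoA, if_neg hN]

lemma excess_le_expoA (H : IsLogConcaveSmooth q) (hρ : 0 ≤ ρ) (hr : Tendsto r (𝓝[>] 0) (𝓝 0))
    (θ : Param d) (hscore : z ∈ eventScoreSup q θs ρ) (hupper : z ∈ eventUpper q θs (coneN θs) r) :
    (excess q ρ (ρ / 4) θs θ z : EReal) ≤ expoA θs ρ r := by
  have hexcess := excess_le_bregman_add hρ θ hscore
  set v := θ - θs with hv
  by_cases hvN : v ∈ coneN θs
  · refine le_trans (EReal.coe_le_coe_iff.2 ?_)
      (coe_le_expoA ⟨v, hvN⟩ ρ r (norm_pos_iff.2 hvN.1))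
    have hbregman := hupper v hvN
    rw [hv, add_sub_cancel, ← hv] at hbregman
    have hsupp : ρ * ∑ j ∈ sparsity θs, |v j| ≤ ρ * (Real.sqrt (l0 θs) * ‖v‖) :=
      mul_le_mul_of_nonneg_left (sum_abs_le_sqrt_card_mul_norm _ v) hρ
    have hsupp0 : 0 ≤ ρ * ∑ j ∈ sparsity θs, |v j| := by positivity
    have hoff : 0 ≤ ρ * ∑ j ∈ (sparsity θs)ᶜ, |v j| := by positivity
    linarith
  · refine le_trans (EReal.coe_le_coe_iff.2 ?_) (expoA_nonneg θs ρ hr)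
    have hoff : 7 * ∑ j ∈ sparsity θs, |v j| ≤ ∑ j ∈ (sparsity θs)ᶜ, |v j| := by
      by_cases hv0 : v = 0
      · simp [hv0]
      · exact (not_le.1 fun h => hvN ⟨hv0, h⟩).le
    have hgain := mul_nonneg hρ (sub_nonneg.2 hoff)
    linarith [bregman_nonpos H θs θ z]

variable {p : Finset (Fin d) → ℝ} {g : ℕ → ℝ} {c₁ c₂ c₃ c₄ L : ℝ}

lemma IsSparsePrior.quasiPosterior_l0_le (H : IsSparsePrior p g c₁ c₂ c₃ c₄)
    (hd : 8 * c₂ ≤ (d : ℝ) ^ c₄) (hq : ∀ θ, 0 < q θ z) (Hq : IsLogConcaveSmooth q)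
    (hρ : 0 < ρ) (hL : 0 ≤ L) (hr : Tendsto r (𝓝[>] 0) (𝓝 0)) (hscore : z ∈ eventScoreSup q θs ρ)
    (hlower : z ∈ eventLower q θs (starCone θs) L) (hupper : z ∈ eventUpper q θs (coneN θs) r)
    (k : ℕ) :
    quasiPosterior (prior p ρ) q z {θ | l0 θs + k ≤ l0 θ} ≤
      2 * (expoA θs ρ r).exp * ENNReal.ofReal ((4 + 4 * L / ρ ^ 2) ^ l0 θs *
        (d.choose (l0 θs) : ℝ) * (4 * c₂ / (d : ℝ) ^ c₄) ^ k) := by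
  have hexcess : ∀ θ ∈ {θ | l0 θs + k ≤ l0 θ},
      ENNReal.ofReal (Real.exp (excess q ρ (ρ / 4) θs θ z)) ≤ (expoA θs ρ r).exp := fun θ _ => by
    rw [← EReal.exp_coe]
    exact EReal.exp_monotone (excess_le_expoA Hq hρ.le hr θ hscore hupper)
  have hratio : 4 * (c₂ / (d : ℝ) ^ c₄) ≤ 1 / 2 := by
    have hdpos : 0 < (d : ℝ) ^ c₄ := by linarith [H.c₂_pos]
    rw [← mul_div_assoc, div_le_iff₀ hdpos]
    linarith
  have hg := H.pos (l0_le θs)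
  refine (H.quasiPosterior_le hq hρ hL (by positivity) hlower le_rfl hexcess).trans ?_
  rw [mul_comm 2, mul_assoc (EReal.exp _) 2, ← ENNReal.ofReal_ofNat 2,
    ← ENNReal.ofReal_mul (by norm_num), div_div_cancel₀ hρ.ne']
  refine mul_le_mul_right (ENNReal.ofReal_le_ofReal ?_) _
  calc d.choose (l0 θs) / g (l0 θs) * (1 + L / ρ ^ 2) ^ l0 θs *
        ∑ t ∈ Finset.Ico (l0 θs + k) (d + 1), g t * 4 ^ t
      ≤ d.choose (l0 θs) / g (l0 θs) * (1 + L / ρ ^ 2) ^ l0 θs *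
        (2 * (g (l0 θs) * 4 ^ l0 θs * (4 * (c₂ / (d : ℝ) ^ c₄)) ^ k)) := by
        gcongr
        exact H.sum_Ico_mul_pow_le (by norm_num) hratio k (l0_le θs)
    _ = 2 * ((4 * (1 + L / ρ ^ 2)) ^ l0 θs * d.choose (l0 θs) *
        (4 * (c₂ / (d : ℝ) ^ c₄)) ^ k) := by
        rw [mul_pow 4 (1 + L / ρ ^ 2)]
        field_simp
    _ = 2 * ((4 + 4 * L / ρ ^ 2) ^ l0 θs * d.choose (l0 θs) * (4 * c₂ / (d : ℝ) ^ c₄) ^ k) := by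
        ring_nf

end Sparsity

section Contraction

variable {d : ℕ} {X : Type*} {q : Param d → X → ℝ} {r : ℝ → ℝ} {θs : Param d} {z : X}
  {Θ : Set (Param d)}

lemma IsRateFunction.tendsto_nhdsGT_zero (hr : IsRateFunction r) :
    Tendsto r (𝓝[>] 0) (𝓝 0) := by
  have hcont := (hr.continuousOn 0 Set.self_mem_Ici).mono Set.Ioi_subset_Ici_self
  rwa [ContinuousWithinAt, hr.zero] at hcont

lemma mul_le_of_rateInv_lt {a y : ℝ} (hy : rateInv r a < ENNReal.ofReal y) : a * y ≤ r y := by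
  simp only [rateInv, iInf_lt_iff] at hy
  obtain ⟨x, ⟨hx0, hx⟩, hxy⟩ := hy
  exact hx y ((ENNReal.ofReal_lt_ofReal_iff_of_nonneg hx0.le).1 hxy).le

lemma bddAbove_coneConst (Θ : Set (Param d)) :
    BddAbove {t | ∃ u ∈ Θ, ∃ v ∈ Θ, ‖v‖ = 1 ∧ t = |∑ j, Real.sign (u j) * v j|} := by
  refine ⟨∑ _j : Fin d, 1, ?_⟩
  rintro t ⟨u, -, v, -, hv, rfl⟩
  refine (Finset.abs_sum_le_sum_abs _ _).trans (Finset.sum_le_sum fun j _ => ?_)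
  have hsign : |Real.sign (u j)| ≤ 1 := by
    rcases Real.sign_apply_eq (u j) with h | h | h <;> simp [h]
  rw [abs_mul]
  exact mul_le_one₀ hsign (abs_nonneg _) ((PiLp.norm_apply_le v j).trans_eq hv)

lemma coneConst_nonneg (Θ : Set (Param d)) : 0 ≤ coneConst Θ := by
  refine Real.sSup_nonneg ?_
  rintro t ⟨u, -, v, -, -, rfl⟩
  exact abs_nonneg _

lemma l1_le_coneConst_mul (hΘ : ∀ t : ℝ, 0 < t → ∀ v ∈ Θ, t • v ∈ Θ) {v : Param d}
    (hv : v ∈ Θ) : l1 v ≤ coneConst Θ * ‖v‖ := by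
  rcases eq_or_ne v 0 with rfl | hv0
  · simp [l1]
  have hpos : 0 < ‖v‖ := norm_pos_iff.2 hv0
  have hsum : ∑ j, Real.sign (v j) * (‖v‖⁻¹ • v) j = ‖v‖⁻¹ * l1 v := by
    rw [l1, Finset.mul_sum]
    refine Finset.sum_congr rfl fun j _ => ?_
    rw [PiLp.smul_apply, smul_eq_mul, mul_left_comm]
    rcases lt_trichotomy (v j) 0 with h | h | h
    · rw [Real.sign_of_neg h, abs_of_neg h, neg_one_mul]
    · simp [h]
    · rw [Real.sign_of_pos h, abs_of_pos h, one_mul]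
  have hle : |∑ j, Real.sign (v j) * (‖v‖⁻¹ • v) j| ≤ coneConst Θ :=
    le_csSup (bddAbove_coneConst Θ) ⟨v, hv, ‖v‖⁻¹ • v, hΘ _ (inv_pos.2 hpos) v hv,
      norm_smul_inv_norm hv0, rfl⟩
  rw [mul_comm, ← inv_mul_le_iff₀ hpos, ← hsum]
  exact (le_abs_self _).trans hle

lemma inner_score_le {lam : ℝ} (hΘ : ∀ t : ℝ, 0 < t → ∀ v ∈ Θ, t • v ∈ Θ)
    (hz : z ∈ eventScore q θs Θ lam) {v : Param d} (hv : v ∈ Θ) :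
    inner ℝ (score q θs z) v ≤ lam / 2 * ‖v‖ := by
  rcases eq_or_ne v 0 with rfl | hv0
  · simp
  have hpos : 0 < ‖v‖ := norm_pos_iff.2 hv0
  have hunit := hz _ (hΘ _ (inv_pos.2 hpos) v hv) (norm_smul_inv_norm hv0)
  rw [inner_smul_right] at hunit
  rw [mul_comm, ← inv_mul_le_iff₀ hpos]
  exact (le_abs_self _).trans hunit

lemma excess_le_of_mem_cone {lam ρ : ℝ} (hρ : 0 ≤ ρ) (a : ℝ)
    (hΘ : ∀ t : ℝ, 0 < t → ∀ v ∈ Θ, t • v ∈ Θ) (hscore : z ∈ eventScore q θs Θ lam)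
    (hupper : z ∈ eventUpper q θs Θ r) {θ : Param d} (hθ : θ - θs ∈ Θ)
    (hrate : 2 * lam * ‖θ - θs‖ ≤ r ‖θ - θs‖) :
    excess q ρ a θs θ z ≤ -(1 / 4) * r ‖θ - θs‖ + (ρ + a) * l1 (θ - θs) := by
  have hinner := inner_score_le hΘ hscore hθ
  have hbregman := hupper _ hθ
  rw [add_sub_cancel] at hbregman
  have hpenalty := mul_le_mul_of_nonneg_left (l1_sub_l1_le_l1_sub θs θ) hρ
  rw [excess, log_sub_log_eq]
  linarith

lemma nonneg_of_monotoneOn_of_tendsto (hr : MonotoneOn r (Set.Ioi 0))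
    (hr0 : Tendsto r (𝓝[>] 0) (𝓝 0)) {x : ℝ} (hx : 0 < x) : 0 ≤ r x := by
  refine le_of_tendsto hr0 ?_
  filter_upwards [Ioo_mem_nhdsGT hx] with y hy using hr hy.1 hx hy.2.le

-- On the shell `(jR, (j+1)R]` we have `jR/2 ≤ x ≤ 2jR`.
lemma ofReal_exp_le_tsum_shell (hr : MonotoneOn r (Set.Ioi 0)) (hr0 : Tendsto r (𝓝[>] 0) (𝓝 0))
    {β R x : ℝ} (hβ : 0 ≤ β) (hR : 0 ≤ R) (hx : R < x) :
    ENNReal.ofReal (Real.exp (-(1 / 4) * r x + β / 2 * x)) ≤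
      ∑' j : ℕ+, ENNReal.ofReal (Real.exp (-(1 / 8) * r (j * R / 2)) * Real.exp (β * (j * R))) := by
  rcases hR.eq_or_lt with rfl | hRpos
  · simp [ENNReal.top_mul, Real.exp_pos]
  obtain ⟨j, hjlt, hjle⟩ := exists_pnat_mul_lt_and_le_add_one_mul hRpos hx
  refine le_trans ?_ (ENNReal.le_tsum j)
  rw [← Real.exp_add]
  refine ENNReal.ofReal_le_ofReal (Real.exp_le_exp.2 ?_)
  have hj : (1 : ℝ) ≤ j := Nat.one_le_cast.2 j.pos
  have hjR : R ≤ j * R := le_mul_of_one_le_left hR hj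
  have hhalf : 0 < j * R / 2 := by positivity
  have hrhalf := nonneg_of_monotoneOn_of_tendsto hr hr0 hhalf
  have hmono : r (j * R / 2) ≤ r x := hr hhalf (hRpos.trans hx) (by linarith)
  have hlin : β * x ≤ β * (2 * (j * R)) := mul_le_mul_of_nonneg_left (by linarith) hβ
  linarith

variable {p : Finset (Fin d) → ℝ} {g : ℕ → ℝ} {c₁ c₂ c₃ c₄ ρ L lam : ℝ}

lemma IsSparsePrior.quasiPosterior_dist_le (H : IsSparsePrior p g c₁ c₂ c₃ c₄)
    (hd : 4 * c₂ ≤ (d : ℝ) ^ c₄) (hq : ∀ θ, 0 < q θ z) (hρ : 0 < ρ) (hL : 0 ≤ L)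
    (hr : MonotoneOn r (Set.Ioi 0)) (hr0 : Tendsto r (𝓝[>] 0) (𝓝 0))
    (hΘ : ∀ t : ℝ, 0 < t → ∀ v ∈ Θ, t • v ∈ Θ) (hscore : z ∈ eventScore q θs Θ lam)
    (hlower : z ∈ eventLower q θs (starCone θs) L) (hupper : z ∈ eventUpper q θs Θ r)
    {R : ℝ} (hR : 0 ≤ R) (hrate : ∀ y, R < y → 2 * lam * y ≤ r y) :
    quasiPosterior (prior p ρ) q z {θ | θ - θs ∈ Θ ∧ R < ‖θ - θs‖} ≤
      ENNReal.ofReal (2 * (d.choose (l0 θs) : ℝ) * ((d : ℝ) ^ c₃ / c₁) ^ l0 θs *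
        (1 + L / ρ ^ 2) ^ l0 θs) *
      ∑' j : ℕ+, ENNReal.ofReal (Real.exp (-(1 / 8) * r (j * R / 2)) *
        Real.exp (3 * ρ * coneConst Θ * (j * R))) := by
  have hexcess : ∀ θ ∈ {θ | θ - θs ∈ Θ ∧ R < ‖θ - θs‖},
      ENNReal.ofReal (Real.exp (excess q ρ (ρ / 2) θs θ z)) ≤
      ∑' j : ℕ+, ENNReal.ofReal (Real.exp (-(1 / 8) * r (j * R / 2)) *
        Real.exp (3 * ρ * coneConst Θ * (j * R))) := by
    rintro θ ⟨hθ, hθR⟩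
    have hβ : 0 ≤ 3 * ρ * coneConst Θ := mul_nonneg (by positivity) (coneConst_nonneg Θ)
    refine le_trans (ENNReal.ofReal_le_ofReal (Real.exp_le_exp.2 ?_))
      (ofReal_exp_le_tsum_shell hr hr0 hβ hR hθR)
    have hl1 := mul_le_mul_of_nonneg_left (l1_le_coneConst_mul hΘ hθ) hρ.le
    linarith [excess_le_of_mem_cone hρ.le (ρ / 2) hΘ hscore hupper hθ (hrate _ hθR)]
  have hratio : 2 * (c₂ / (d : ℝ) ^ c₄) ≤ 1 / 2 := by
    have hdpos : 0 < (d : ℝ) ^ c₄ := by linarith [H.c₂_pos]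
    rw [← mul_div_assoc, div_le_iff₀ hdpos]
    linarith
  have hg := H.pos (l0_le θs)
  have hg0 : g 0 ≤ ((d : ℝ) ^ c₃ / c₁) ^ l0 θs * g (l0 θs) := by
    simpa using H.apply_le_add (s := 0) (n := l0 θs) (by simpa using l0_le θs)
  refine (H.quasiPosterior_le hq hρ hL (half_pos hρ) hlower (m := 0) (fun _ _ => Nat.zero_le _)
    hexcess).trans ?_
  rw [mul_comm, div_div_cancel₀ hρ.ne']
  refine mul_le_mul_left (ENNReal.ofReal_le_ofReal ?_) _
  calc d.choose (l0 θs) / g (l0 θs) * (1 + L / ρ ^ 2) ^ l0 θs *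
        ∑ t ∈ Finset.Ico 0 (d + 1), g t * 2 ^ t
      ≤ d.choose (l0 θs) / g (l0 θs) * (1 + L / ρ ^ 2) ^ l0 θs * (2 * g 0) := by
        gcongr
        simpa using H.sum_Ico_mul_pow_le zero_le_two hratio 0 (Nat.zero_le d)
    _ ≤ d.choose (l0 θs) / g (l0 θs) * (1 + L / ρ ^ 2) ^ l0 θs *
        (2 * (((d : ℝ) ^ c₃ / c₁) ^ l0 θs * g (l0 θs))) := by gcongr
    _ = 2 * d.choose (l0 θs) * ((d : ℝ) ^ c₃ / c₁) ^ l0 θs * (1 + L / ρ ^ 2) ^ l0 θs := by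
        field_simp

end Contraction

section Law

variable {d : ℕ} {X : Type*} [MeasurableSpace X] {ν : Measure X}

lemma IsDensityFamily.isProbabilityMeasure_law {f : Param d → X → ℝ} (hf : IsDensityFamily ν f)
    (θ : Param d) : IsProbabilityMeasure (law ν f θ) where
  measure_univ := by
    rw [law, withDensity_apply _ MeasurableSet.univ, Measure.restrict_univ, (hf θ).2.2]

lemma IsQuasiLikelihood.of_absolutelyContinuous {P : Measure X} {Pr : Measure (Param d)}
    {q : Param d → X → ℝ} (hq : IsQuasiLikelihood ν Pr q) (hP : P ≪ ν) :
    IsQuasiLikelihood P Pr q where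
  pos := hq.pos
  measurable := hq.measurable
  normalizable := hP.ae_le hq.normalizable

end Law

end QuasiPosterior

open QuasiPosterior in
theorem theorem1_general {d : ℕ} {X : Type*} [MeasurableSpace X] (P : Measure X)
    [IsProbabilityMeasure P] (q : Param d → X → ℝ) (θs : Param d) (p : Finset (Fin d) → ℝ)
    (g : ℕ → ℝ) (ρ c₁ c₂ c₃ c₄ : ℝ) (hρ : 0 < ρ) (hq : IsQuasiLikelihood P (prior p ρ) q)
    (H1 : IsLogConcaveSmooth q) (H2 : IsSparsePrior p g c₁ c₂ c₃ c₄)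
    (hd : 8 * c₂ ≤ (d : ℝ) ^ c₄) (Θ : Set (Param d)) (hΘ : ∀ t : ℝ, 0 < t → ∀ v ∈ Θ, t • v ∈ Θ)
    (L lam : ℝ) (hL : 0 ≤ L) (r : ℝ → ℝ) (hr : MonotoneOn r (Set.Ioi 0))
    (hr0 : Tendsto r (𝓝[>] 0) (𝓝 0)) :
    (∀ k : ℕ,
      ∫⁻ z, quasiPosterior (prior p ρ) q z {θ | l0 θs + k ≤ l0 θ} ∂P ≤
        P (eventScoreSup q θs ρ ∩
          (eventLower q θs (starCone θs) L ∩ eventUpper q θs (coneN θs) r))ᶜ +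
        2 * (expoA θs ρ r).exp * ENNReal.ofReal ((4 + 4 * L / ρ ^ 2) ^ l0 θs *
          (d.choose (l0 θs) : ℝ) * (4 * c₂ / (d : ℝ) ^ c₄) ^ k)) ∧
    ∀ R : ℝ, 0 ≤ R → rateInv r (2 * lam) ≤ ENNReal.ofReal R →
      ∫⁻ z, quasiPosterior (prior p ρ) q z {θ | θ - θs ∈ Θ ∧ R < ‖θ - θs‖} ∂P ≤
        P (eventScore q θs Θ lam ∩ eventLower q θs (starCone θs) L ∩ eventUpper q θs Θ r)ᶜ +
        ENNReal.ofReal (2 * (d.choose (l0 θs) : ℝ) * ((d : ℝ) ^ c₃ / c₁) ^ l0 θs *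
          (1 + L / ρ ^ 2) ^ l0 θs) *
          ∑' j : ℕ+, ENNReal.ofReal (Real.exp (-(1 / 8) * r (j * R / 2)) *
            Real.exp (3 * ρ * coneConst Θ * (j * R))) := by
  have hd' : 4 * c₂ ≤ (d : ℝ) ^ c₄ := by linarith [H2.c₂_pos]
  constructor
  · intro k
    refine lintegral_le_measure_compl_add P (fun z => quasiPosterior_le_one _ q z _) ?_
    rintro z ⟨hscore, hlower, hupper⟩
    exact H2.quasiPosterior_l0_le hd (hq.pos · z) H1 hρ hL hr0 hscore hlower hupper k
  · intro R hR hRrate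
    refine lintegral_le_measure_compl_add P (fun z => quasiPosterior_le_one _ q z _) ?_
    rintro z ⟨⟨hscore, hlower⟩, hupper⟩
    exact H2.quasiPosterior_dist_le hd' (hq.pos · z) hρ hL hr hr0 hΘ hscore hlower hupper
      hR fun y hy =>
        mul_le_of_rateInv_lt (hRrate.trans_lt ((ENNReal.ofReal_lt_ofReal_iff_of_nonneg hR).2 hy))

theorem theorem1 {d : ℕ} {X : Type*} [MeasurableSpace X]
    (ν : MeasureTheory.Measure X) [MeasureTheory.SigmaFinite ν]
    (f q : QuasiPosterior.Param d → X → ℝ) (θs : QuasiPosterior.Param d)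
    (p : Finset (Fin d) → ℝ) (g : ℕ → ℝ) (ρ c₁ c₂ c₃ c₄ : ℝ)
    (hρ : 0 < ρ)
    (hf : QuasiPosterior.IsDensityFamily ν f)
    (hq : QuasiPosterior.IsQuasiLikelihood ν (QuasiPosterior.prior p ρ) q)
    (H1 : QuasiPosterior.IsLogConcaveSmooth q)
    (H2 : QuasiPosterior.IsSparsePrior p g c₁ c₂ c₃ c₄)
    (hd : 8 * c₂ ≤ (d : ℝ) ^ c₄)
    (Θ : Set (QuasiPosterior.Param d)) (hΘ : QuasiPosterior.IsSplitCone Θ)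
    (hΘm : MeasurableSet Θ) (hΘs : QuasiPosterior.starCone θs ⊆ Θ)
    (L lam : ℝ) (hL : 0 ≤ L) (hlam : 0 ≤ lam)
    (r : ℝ → ℝ) (hr : QuasiPosterior.IsRateFunction r)
    (hfin : QuasiPosterior.rateInv r (2 * lam) < ∞) :
    let P := QuasiPosterior.law ν f θs
    let post := QuasiPosterior.quasiPosterior (QuasiPosterior.prior p ρ) q
    let s := QuasiPosterior.l0 θs
    let ε := (QuasiPosterior.rateInv r (2 * lam)).toReal
    let curv := QuasiPosterior.eventLower q θs (QuasiPosterior.starCone θs) L ∩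
      QuasiPosterior.eventUpper q θs (QuasiPosterior.coneN θs) r
    let bound1 : ℕ → ℝ≥0∞ := fun k =>
      2 * (QuasiPosterior.expoA θs ρ r).exp *
        ENNReal.ofReal ((4 + 4 * L / ρ ^ 2) ^ s * (d.choose s : ℝ) *
          (4 * c₂ / (d : ℝ) ^ c₄) ^ k)
    -- Part (1), with the event `E₀(ℝ^d, ρ)`
    (∀ k : ℕ,
      ∫⁻ z, post z {θ | s + k ≤ QuasiPosterior.l0 θ} ∂P ≤
        P (QuasiPosterior.eventScore q θs Set.univ ρ ∩ curv)ᶜ + bound1 k) ∧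
    -- Part (1), with the larger event `{‖∇ log q_{θ⋆}‖_∞ ≤ ρ/2}` in place of `E₀(ℝ^d, ρ)`
    (∀ k : ℕ,
      ∫⁻ z, post z {θ | s + k ≤ QuasiPosterior.l0 θ} ∂P ≤
        P (QuasiPosterior.eventScoreSup q θs ρ ∩ curv)ᶜ + bound1 k) ∧
    -- Part (2)
    (∀ M : ℝ, 2 < M →
      ∫⁻ z, post z {θ | θ - θs ∈ Θ ∧ M * ε < ‖θ - θs‖} ∂P ≤
        P (QuasiPosterior.eventScore q θs Θ lam ∩
            QuasiPosterior.eventLower q θs (QuasiPosterior.starCone θs) L ∩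
            QuasiPosterior.eventUpper q θs Θ r)ᶜ +
        ∑' j : ℕ+,
          (QuasiPosterior.packing ((j : ℝ) * M * ε / 2)
            (QuasiPosterior.coneBall θs Θ (((j : ℝ) + 1) * M * ε)) : ℝ≥0∞) *
          ENNReal.ofReal (Real.exp (-(1 / 8) * r ((j : ℝ) * M * ε / 2))) +
        ENNReal.ofReal (2 * (d.choose s : ℝ) * ((d : ℝ) ^ c₃ / c₁) ^ s * (1 + L / ρ ^ 2) ^ s) *
          ∑' j : ℕ+,
            ENNReal.ofReal (Real.exp (-(1 / 8) * r ((j : ℝ) * M * ε / 2)) *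
              Real.exp (3 * ρ * QuasiPosterior.coneConst Θ * (j : ℝ) * M * ε))) := by
  intro P post s ε curv bound1
  have hP := hf.isProbabilityMeasure_law θs
  obtain ⟨hsparse, hdist⟩ := theorem1_general P q θs p g ρ c₁ c₂ c₃ c₄ hρ
    (hq.of_absolutelyContinuous (withDensity_absolutelyContinuous _ _)) H1 H2 hd Θ
    (fun t ht => hΘ.smul_mem t ht.le) L lam hL r
    (hr.strictMonoOn.monotoneOn.mono Set.Ioi_subset_Ici_self) hr.tendsto_nhdsGT_zero
  refine ⟨fun k => (hsparse k).trans ?_, hsparse, fun M hM => ?_⟩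
  · gcongr
    exact QuasiPosterior.eventScore_univ_subset q θs ρ
  · have hε : 0 ≤ ε := ENNReal.toReal_nonneg
    have hεM : ε ≤ M * ε := le_mul_of_one_le_left hε (by linarith)
    refine (hdist (M * ε) (hε.trans hεM)
      ((ENNReal.le_ofReal_iff_toReal_le hfin.ne (hε.trans hεM)).2 hεM)).trans ?_
    simp only [← mul_assoc]
    gcongr
    exact le_self_add
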